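/- Let $d\ge 1$ be an integer and let $\mathcal I_d$ be the set of all triples $\mathbf i=(i,j,k)$ of non-negative integers with $i+j+k=d$. For $z\in\{0,1,2\}$ let $\mathcal I_d^{(z)}\subset\mathcal I_d$ be the set of triples with exactly $z$ components equal to zero. For $\mathbf j=(i,j,k)\in\mathcal I_d$ let $$B^d_{\mathbf j}(u,v,w)=\frac{d!}{i!\,j!\,k!}\,u^iv^jw^k\qquad(0^0=1)$$ be the Bernstein basis polynomial of degree $d$ in barycentric coordinates $(u,v,w)$, $u+v+w=1$, with respect to a triangle, and let $\xi_{\mathbf i}=\mathbf i/d$, $\mathbf i\in\mathcal I_d$, be the domain points of the triangle in barycentric coordinates. For $\Gamma\subset\mathcal I_d$ let $$M_\Gamma=\bigl[B^d_{\mathbf j}(\xi_{\mathbf i})\bigr]_{\mathbf i,\mathbf j\in\Gamma}$$ (rows indexed by $\mathbf i$, columns by $\mathbf j$, in the same order; if $\Gamma=\emptyset$, the determinant is $1$). Suppose that $\Gamma\subset\mathcal I_d$ satisfies one of the following assumptions: 1. $|\Gamma|\le 2$; 2. one of the three components of $(i,j,k)$ has the same value for all elements of $\Gamma$; 3. $\Gamma=\mathcal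 I_d$; 4. $\Gamma=\mathcal I_d^{(0)}$; 5. $\Gamma\subset\mathcal I_d^{(2)}\cup\mathcal I_d^{(1)}$; 6. $\Gamma=\Gamma_1\cup\Gamma_2$, where $\Gamma_1$ is a set as in 1, 2 or 4, and $\Gamma_2$ is a set as in 5. Then $\det M_\Gamma>0$. -/

import Mathlib

namespace BezierTriangle

/-- The set `I_d` of weak 3-compositions of `d`: triples of natural numbers with sum `d`. -/
def indices (d : ℕ) : Finset (Fin 3 → ℕ) :=
  Finset.Nat.antidiagonalTuple 3 d

/-- The set `I_d^{(z)}` of those weak 3-compositions of `d` that have exactly `z` zero components. -/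
def indicesWithZeros (d z : ℕ) : Finset (Fin 3 → ℕ) :=
  (indices d).filter fun i => (Finset.univ.filter fun c : Fin 3 => i c = 0).card = z

/-- The Bernstein basis polynomial `B_j^d` on a triangle, as a function of the barycentric
coordinates `v`; the convention `0 ^ 0 = 1` is in force. -/
noncomputable def bernsteinPoly (d : ℕ) (j : Fin 3 → ℕ) (v : Fin 3 → ℝ) : ℝ :=
  (d.factorial : ℝ) / ((j 0).factorial * (j 1).factorial * (j 2).factorial)
    * (v 0 ^ j 0 * v 1 ^ j 1 * v 2 ^ j 2)

/-- The domain point `ξ_i = i / d`, in barycentric coordinates. -/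
noncomputable def domainPoint (d : ℕ) (i : Fin 3 → ℕ) : Fin 3 → ℝ :=
  fun c => (i c : ℝ) / (d : ℝ)

/-- The collocation matrix `M_Γ = [B_j^d(ξ_i)]` with rows `i ∈ Γ` and columns `j ∈ Γ`. -/
noncomputable def collocationMatrix (d : ℕ) (Γ : Finset (Fin 3 → ℕ)) : Matrix Γ Γ ℝ :=
  Matrix.of fun i j => bernsteinPoly d j.1 (domainPoint d i.1)

/-- The cardinality of `Γ` is at most two. -/
def AtMostTwo (Γ : Finset (Fin 3 → ℕ)) : Prop :=
  Γ.card ≤ 2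

/-- One of the three components has the same value for all elements of `Γ`. -/
def OneComponentFixed (Γ : Finset (Fin 3 → ℕ)) : Prop :=
  ∃ (c : Fin 3) (m : ℕ), ∀ i ∈ Γ, i c = m

/-- `Γ` consists of boundary indices: at least one component is zero, but not all three. -/
def IsBoundary (d : ℕ) (Γ : Finset (Fin 3 → ℕ)) : Prop :=
  Γ ⊆ indicesWithZeros d 2 ∪ indicesWithZeros d 1

end BezierTriangle

/-! Up to positive row and column factors, `M_Γ` is the matrix of monomials `i^j = ∏ c, i_c ^ j_c`.
An entry vanishes when `i_c = 0 ≠ j_c` for some `c`, so grouping indices by their zero components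
makes the matrix block triangular (`det_powMatrix_pos_of_interior_block`).

On a boundary block one component is constantly zero. With a component fixed, the other two have
constant sum `n`, and `p^p' q^q' = q^n (p/q)^p'` is a rescaled generalized Vandermonde matrix in the
nodes `p/q`; its determinant is positive by Descartes' rule of signs.

There remains the interior block. With a fixed component the same argument applies; with at most two
points a direct inequality suffices. If all interior indices occur, unimodular column operations and
positive scalings turn the monomials into products of falling factorials, which are triangular on
the lattice. -/

open Matrix

/-! ### Descartes' bound on positive roots -/

namespace Polynomial

theorem signVariations_le_card_support (P : Polynomial ℝ) :
    P.signVariations ≤ P.support.card - 1 := by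
  induction hn : P.support.card generalizing P with
  | zero => rw [Polynomial.card_support_eq_zero.mp hn]; simp
  | succ n ih =>
    -- A single term is treated apart: with truncated `0 - 1`, the inductive step would only give
    -- the bound 1.
    rcases Nat.eq_zero_or_pos n with rfl | hpos
    · obtain ⟨k, x, -, rfl⟩ := Polynomial.card_support_eq_one.mp hn
      rw [C_mul_X_pow_eq_monomial]; simp
    · have h1 := ih P.eraseLead (Polynomial.card_support_eraseLead' hn)
      have h2 := Polynomial.signVariations_le_eraseLead_succ (P := P)
      omega

/-- A nonzero real polynomial with at most `n` terms has fewer than `n` distinct positive roots. -/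
theorem card_pos_roots_lt_of_card_support_le {P : Polynomial ℝ} (hP : P ≠ 0) {n : ℕ}
    (hn : P.support.card ≤ n) (s : Finset ℝ) (hs : ∀ x ∈ s, 0 < x ∧ P.IsRoot x) :
    s.card < n := by
  have hpos : 0 < P.support.card := by
    rw [Nat.pos_iff_ne_zero, Ne, Polynomial.card_support_eq_zero]; exact hP
  have h1 := P.roots_countP_pos_le_signVariations
  have h2 := P.signVariations_le_card_support
  have h3 : s.card ≤ P.roots.countP (0 < ·) := by
    rw [Multiset.countP_eq_card_filter]
    refine Multiset.card_le_card ((Multiset.le_iff_subset s.nodup).mpr fun x hx => ?_)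
    obtain ⟨h0, hr⟩ := hs x hx
    exact Multiset.mem_filter.mpr ⟨(mem_roots hP).mpr hr, h0⟩
  omega

end Polynomial

/-! ### Generalized Vandermonde and graded determinants -/

namespace Matrix

/-- Generalized Vandermonde determinants with increasing positive nodes and increasing exponents
are positive. -/
theorem det_pow_pos_of_strictMono {n : ℕ} (x : Fin n → ℝ) (k : Fin n → ℕ) (hx : StrictMono x)
    (hk : StrictMono k) (hpos : ∀ i, 0 < x i) : 0 < (of fun i j => x i ^ k j).det := by
  induction n with
  | zero => simp
  | succ n ih =>
    classical
    set M : Matrix (Fin (n + 1)) (Fin (n + 1)) ℝ := of fun i j => x i ^ k j with hM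
    -- Cofactors of the last row: `P` is the determinant as a function of the last node, with
    -- leading coefficient a smaller determinant of the same kind.
    let c : Fin (n + 1) → ℝ := fun j =>
      (-1) ^ (n + (j : ℕ)) * (M.submatrix (Fin.last n).succAbove j.succAbove).det
    let P : Polynomial ℝ := ∑ j, Polynomial.monomial (k j) (c j)
    have heval : ∀ t : ℝ, P.eval t = (M.updateRow (Fin.last n) fun j => t ^ k j).det := by
      intro t
      rw [det_succ_row _ (Fin.last n), Polynomial.eval_finsetSum]
      refine Finset.sum_congr rfl fun j _ => ?_
      rw [Polynomial.eval_monomial, submatrix_updateRow_succAbove]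
      simp only [c, updateRow_self, Fin.val_last]
      ring
    have hlast : 0 < c (Fin.last n) := by
      have h := ih (fun i => x i.castSucc) (fun j => k j.castSucc)
        (fun a b hab => hx (Fin.castSucc_lt_castSucc_iff.mpr hab))
        (fun a b hab => hk (Fin.castSucc_lt_castSucc_iff.mpr hab)) (fun i => hpos _)
      have h2 : M.submatrix (Fin.last n).succAbove (Fin.last n).succAbove =
          of fun i j : Fin n => x i.castSucc ^ k j.castSucc := by
        ext i j; simp [hM]
      simp only [c, Fin.val_last, h2]
      rw [← two_mul, pow_mul]; simpa using h
    have hcoeff : P.coeff (k (Fin.last n)) = c (Fin.last n) := by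
      simp only [P, Polynomial.finsetSum_coeff, Polynomial.coeff_monomial, hk.injective.eq_iff]
      simp
    have hP : P ≠ 0 := by
      intro h; rw [h] at hcoeff; simp at hcoeff; exact hlast.ne hcoeff
    have hsupp : P.support ⊆ Finset.univ.image k := by
      intro m hm
      by_contra hne
      refine (Polynomial.mem_support_iff.mp hm) ?_
      simp only [P, Polynomial.finsetSum_coeff, Polynomial.coeff_monomial]
      refine Finset.sum_eq_zero fun j _ => if_neg fun h => hne ?_
      exact Finset.mem_image.mpr ⟨j, Finset.mem_univ _, h⟩
    have hcard : P.support.card ≤ n + 1 :=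
      (Finset.card_le_card hsupp).trans (Finset.card_image_le.trans (by simp))
    have hroot : ∀ i : Fin n, P.eval (x i.castSucc) = 0 := by
      intro i
      rw [heval]
      refine det_zero_of_row_eq (Fin.castSucc_lt_last i).ne ?_
      ext j
      rw [updateRow_self, updateRow_ne (Fin.castSucc_lt_last i).ne]
      simp [hM]
    -- The `n` earlier nodes are already roots, and at most `n + 1` terms allow no further positive
    -- one.
    have hnoroot : ∀ t, x (Fin.last n) ≤ t → P.eval t ≠ 0 := by
      intro t ht h0
      have hlt : ∀ i : Fin n, x i.castSucc < t := fun i => (hx (Fin.castSucc_lt_last i)).trans_le ht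
      have := Polynomial.card_pos_roots_lt_of_card_support_le hP hcard
        (insert t (Finset.univ.image fun i : Fin n => x i.castSucc)) (by
          intro y hy
          rcases Finset.mem_insert.mp hy with rfl | hy
          · exact ⟨(hpos _).trans_le ht, h0⟩
          · obtain ⟨i, -, rfl⟩ := Finset.mem_image.mp hy
            exact ⟨hpos _, hroot i⟩)
      rw [Finset.card_insert_of_notMem, Finset.card_image_of_injective] at this
      · simp at this
      · intro a b hab
        exact Fin.castSucc_injective _ (hx.injective hab)
      · intro hmem
        obtain ⟨i, -, hi⟩ := Finset.mem_image.mp hmem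
        exact (hlt i).ne hi
    have hnat : P.natDegree = k (Fin.last n) := by
      refine le_antisymm (Polynomial.natDegree_sum_le_of_forall_le _ _ fun j _ => ?_) ?_
      · exact (Polynomial.natDegree_monomial_le _).trans (hk.monotone (Fin.le_last j))
      · exact Polynomial.le_natDegree_of_ne_zero (by rw [hcoeff]; exact hlast.ne')
    have hself : M.det = P.eval (x (Fin.last n)) := by
      rw [heval]
      congr 1
      refine (updateRow_eq_self M (Fin.last n)).symm.trans ?_
      rfl
    have hlead : 0 < P.leadingCoeff := by
      rw [Polynomial.leadingCoeff, hnat, hcoeff]; exact hlast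
    rw [hself]
    by_contra! hneg
    have hbig : ∃ t, x (Fin.last n) ≤ t ∧ 0 < P.eval t := by
      rcases Nat.eq_zero_or_pos P.natDegree with h0 | h0
      · refine ⟨x (Fin.last n), le_rfl, ?_⟩
        have := Polynomial.eq_C_of_natDegree_eq_zero h0
        rw [this, Polynomial.eval_C]
        rwa [Polynomial.leadingCoeff, h0] at hlead
      · have ht := P.tendsto_atTop_of_leadingCoeff_nonneg
          (Polynomial.natDegree_pos_iff_degree_pos.mp h0) hlead.le
        obtain ⟨t, h1, h2⟩ := ((ht.eventually_gt_atTop 0).and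
          (Filter.eventually_ge_atTop (x (Fin.last n)))).exists
        exact ⟨t, h2, h1⟩
    obtain ⟨t, ht, htpos⟩ := hbig
    obtain ⟨y, hy, hy0⟩ := intermediate_value_Icc ht P.continuous.continuousOn
      (Set.mem_Icc.mpr ⟨hneg, htpos.le⟩)
    exact hnoroot y hy.1 hy0

/-- Generalized Vandermonde determinants with nodes and exponents increasing along the same
injective labelling are positive. -/
theorem det_pow_pos_of_lt_imp_lt {ι : Type*} [Fintype ι] [DecidableEq ι] (p : ι → ℕ)
    (hp : Function.Injective p) (x : ι → ℝ) (k : ι → ℕ) (hx : ∀ i j, p i < p j → x i < x j)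
    (hk : ∀ i j, p i < p j → k i < k j) (hpos : ∀ i, 0 < x i) :
    0 < (of fun i j => x i ^ k j).det := by
  let _ : LinearOrder ι := LinearOrder.lift' p hp
  let f := Fintype.orderIsoFinOfCardEq ι rfl
  have h := det_pow_pos_of_strictMono (x ∘ f) (k ∘ f)
    (fun a b hab => hx _ _ (f.strictMono hab)) (fun a b hab => hk _ _ (f.strictMono hab))
    (fun i => hpos _)
  rw [← det_submatrix_equiv_self f.toEquiv]
  exact h

/-- A matrix that is triangular with respect to a grading has determinant the product of its
diagonal entries. -/
theorem det_eq_prod_diag_of_grading {ι R : Type*} [Fintype ι] [DecidableEq ι] [CommRing R]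
    (r : ι → ℕ) (A : Matrix ι ι R) (h : ∀ i j, A i j ≠ 0 → i ≠ j → r j < r i) :
    A.det = ∏ i, A i i := by
  rw [det_apply]
  refine (Finset.sum_eq_single_of_mem 1 (Finset.mem_univ _) fun σ _ hσ => ?_).trans (by simp)
  -- Otherwise `σ` never lowers the grade and raises it somewhere, although it preserves the sum of
  -- all grades.
  obtain ⟨i, hi⟩ : ∃ i, A (σ i) i = 0 := by
    by_contra! hne
    have hle : ∀ i, r i ≤ r (σ i) := fun i => by
      by_cases hs : σ i = i
      · rw [hs]
      · exact (h _ _ (hne i) hs).le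
    obtain ⟨i, hi⟩ : ∃ i, σ i ≠ i := by
      by_contra! hall
      exact hσ (Equiv.ext hall)
    have hlt : ∑ i, r i < ∑ i, r (σ i) :=
      Finset.sum_lt_sum (fun i _ => hle i) ⟨i, Finset.mem_univ _, h _ _ (hne i) hi⟩
    rw [Equiv.sum_comp σ r] at hlt
    exact lt_irrefl _ hlt
  have hz : ∏ j, A (σ j) j = 0 := Finset.prod_eq_zero (Finset.mem_univ i) hi
  simp [hz]

/-- Adding to each column a combination of columns of smaller grade does not change the
determinant. -/
theorem det_eq_of_sub_mem_span {ι R : Type*} [Fintype ι] [DecidableEq ι] [CommRing R]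
    (r : ι → ℕ) (f g : ι → ι → R)
    (h : ∀ j, g j - f j ∈ Submodule.span R (f '' {l | r l < r j})) :
    (of fun i j => g j i).det = (of fun i j => f j i).det := by
  have h' : ∀ j, ∃ c : ι → R, (∀ l, c l ≠ 0 → r l < r j) ∧ g j - f j = ∑ l, c l • f l := by
    intro j
    obtain ⟨c, hc, hs⟩ := (Finsupp.mem_span_image_iff_linearCombination R).mp (h j)
    refine ⟨c, fun l hl => hc (Finsupp.mem_support_iff.mpr hl), ?_⟩
    rw [← hs, Finsupp.linearCombination_apply, Finsupp.sum_fintype _ _ (by simp)]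
  choose c hc hs using h'
  -- The change-of-columns matrix is unitriangular for the grading.
  have hmul : (of fun i j => g j i) = (of fun i j => f j i) * (1 + of fun l j => c j l) := by
    ext i j
    have := congrFun (hs j) i
    simp only [Pi.sub_apply, Finset.sum_apply, Pi.smul_apply, smul_eq_mul] at this
    rw [Matrix.mul_add, Matrix.mul_one, add_apply, Matrix.mul_apply]
    simp only [of_apply]
    rw [← sub_eq_iff_eq_add', this]
    exact Finset.sum_congr rfl fun l _ => mul_comm _ _
  have hone : (1 + of fun l j => c j l : Matrix ι ι R).det = 1 := by
    rw [← det_transpose, det_eq_prod_diag_of_grading r]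
    · have hz : ∀ j, c j j = 0 := fun j => by
        by_contra hne
        exact lt_irrefl _ (hc j j hne)
      simp [hz]
    · intro i j hij hne
      refine hc i j fun h0 => hij ?_
      simp [hne.symm, h0]
  rw [hmul, det_mul, hone, mul_one]

end Matrix

/-! ### Column reduction modulo lower-order monomials -/

namespace BezierTriangle

section Span

variable {A : Type*} [CommRing A] [Algebra ℝ A]

/-- Each factor `Z = D - X - Y` is replaced by `D`; the error terms have a smaller power of `D`, the
quantity filtered by `V`. Keeping `D` as an element makes the identity homogeneous of degree `n`. -/
theorem monomial_sub_monomial_mem {V : ℕ → Submodule ℝ A} (hV : Monotone V) {X Y Z D : A}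
    (hZ : Z = D - X - Y) {n : ℕ} (h : ∀ a b r, a + b + r = n → X ^ a * Y ^ b * D ^ r ∈ V (r + 1))
    (c : ℕ) : ∀ a b t, a + b + c + t = n →
      X ^ a * Y ^ b * Z ^ c * D ^ t - X ^ a * Y ^ b * D ^ (c + t) ∈ V (c + t) := by
  induction c with
  | zero => intro a b t _; simp
  | succ c ih =>
    intro a b t hn
    have h1 := ih a b (t + 1) (by omega)
    have h2 := hV (Nat.le_succ _) (ih (a + 1) b t (by omega))
    have h3 := hV (Nat.le_succ _) (ih a (b + 1) t (by omega))
    have h4 := h (a + 1) b (c + t) (by omega)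
    have h5 := h a (b + 1) (c + t) (by omega)
    have h6 := Submodule.sub_mem _ (Submodule.sub_mem _ h1 (Submodule.add_mem _ h2 h4))
      (Submodule.add_mem _ h3 h5)
    rw [show c + 1 + t = c + (t + 1) by ring]
    convert h6 using 1
    rw [pow_succ Z]
    -- Only the split-off factor `Z` is expanded; `Z ^ c` stays for the induction hypothesis.
    nth_rewrite 2 [hZ]
    ring

/-- The falling factorial `(X - 1) (X - 2) ⋯ (X - p)`. -/
def shiftedFalling (X : A) (p : ℕ) : A :=
  ∏ t ∈ Finset.range p, (X - ((t + 1 : ℕ) : A))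

/-- Here `W` filters by total degree. The exponents `a`, `b` collect the variables from factors
already expanded, while each constant term lowers the degree. -/
theorem shiftedFalling_sub_monomial_mem {W : ℕ → Submodule ℝ A} (hW : Monotone W) {X Y : A}
    {n : ℕ} (h : ∀ a b, a + b ≤ n → X ^ a * Y ^ b ∈ W (a + b + 1)) (p q : ℕ) :
    ∀ a b, p + q + a + b ≤ n →
      shiftedFalling X p * shiftedFalling Y q * X ^ a * Y ^ b - X ^ (p + a) * Y ^ (q + b)
        ∈ W (p + q + a + b) := by
  induction p with
  | zero =>
    induction q with
    | zero => intro a b _; simp [shiftedFalling]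
    | succ q ih =>
      intro a b hn
      have h1 := ih a (b + 1) (by omega)
      have h2 := hW (Nat.le_succ _) (ih a b (by omega))
      have h3 := h a (q + b) (by omega)
      have h4 := Submodule.sub_mem _ h1 ((W _).smul_of_tower_mem (q + 1) (Submodule.add_mem _ h2
        (hW (show a + (q + b) + 1 ≤ _ by omega) h3)))
      rw [show 0 + (q + 1) + a + b = 0 + q + a + (b + 1) by ring]
      convert h4 using 1
      rw [nsmul_eq_mul, shiftedFalling, shiftedFalling, shiftedFalling, Finset.prod_range_succ]
      ring
  | succ p ih =>
    intro a b hn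
    have h1 := ih (a + 1) b (by omega)
    have h2 := hW (Nat.le_succ _) (ih a b (by omega))
    have h3 := h (p + a) (q + b) (by omega)
    have h4 := Submodule.sub_mem _
      (hW (show _ ≤ p + 1 + q + a + b by omega) h1) ((W _).smul_of_tower_mem (p + 1)
        (hW (show _ ≤ p + 1 + q + a + b by omega) (Submodule.add_mem _ h2
          (hW (show p + a + (q + b) + 1 ≤ (p + q + a + b).succ by omega) h3))))
    convert h4 using 1
    rw [nsmul_eq_mul, shiftedFalling, shiftedFalling, shiftedFalling, Finset.prod_range_succ]
    ring

end Span

theorem shiftedFalling_apply {ι : Type*} (X : ι → ℝ) (p : ℕ) (i : ι) :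
    shiftedFalling X p i = shiftedFalling (X i) p := by
  simp [shiftedFalling, Finset.prod_apply]

theorem shiftedFalling_eq_zero {u p : ℕ} (hu : 0 < u) (h : u ≤ p) :
    shiftedFalling (u : ℝ) p = 0 := by
  refine Finset.prod_eq_zero (i := u - 1) (Finset.mem_range.mpr (by omega)) ?_
  rw [Nat.sub_add_cancel hu, sub_self]

theorem shiftedFalling_pos {u p : ℕ} (h : p < u) : 0 < shiftedFalling (u : ℝ) p := by
  refine Finset.prod_pos fun t ht => sub_pos.mpr ?_
  have := Finset.mem_range.mp ht
  exact_mod_cast (by omega : t + 1 < u)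

/-! ### Positivity of the monomial matrix -/

section PowMatrix

variable {ι : Type*}

/-- The matrix of all monomials with exponents `e j`, evaluated at the points `e i`. -/
def powMatrix (e : ι → Fin 3 → ℕ) : Matrix ι ι ℝ :=
  of fun i j => ∏ c, (e i c : ℝ) ^ e j c

theorem powMatrix_diag_pos (e : ι → Fin 3 → ℕ) (i : ι) : 0 < powMatrix e i i := by
  rw [powMatrix, of_apply]
  refine Finset.prod_pos fun c _ => ?_
  rcases Nat.eq_zero_or_pos (e i c) with h | h
  · simp [h]
  · positivity

variable [Fintype ι] [DecidableEq ι]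

theorem det_powMatrix_pos_of_subsingleton [Subsingleton ι] (e : ι → Fin 3 → ℕ) :
    0 < (powMatrix e).det := by
  cases isEmpty_or_nonempty ι
  · simp
  · obtain ⟨i⟩ := ‹Nonempty ι›
    rw [det_eq_elem_of_subsingleton _ i]
    exact powMatrix_diag_pos e i

theorem det_mul_row_column_pos (a b : ι → ℝ) (ha : ∀ i, 0 < a i) (hb : ∀ i, 0 < b i)
    {A B : Matrix ι ι ℝ} (hA : 0 < A.det) (h : ∀ i j, B i j = a i * (b j * A i j)) :
    0 < B.det := by
  have hB : B = of fun i j => a i * (of fun i j => b j * A i j) i j := by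
    ext i j; exact h i j
  rw [hB, det_mul_column, det_mul_row]
  exact mul_pos (Finset.prod_pos fun i _ => ha i) (mul_pos (Finset.prod_pos fun i _ => hb i) hA)

theorem det_powMatrix_pos_of_interior {d : ℕ} (e : ι → Fin 3 → ℕ) (he : Function.Injective e)
    (hd : ∀ i, e i 0 + e i 1 + e i 2 = d) (hpos : ∀ i c, e i c ≠ 0)
    (hsurj : ∀ f : Fin 3 → ℕ, (∀ c, f c ≠ 0) → f 0 + f 1 + f 2 = d → ∃ i, e i = f) :
    0 < (powMatrix e).det := by
  have hp0 : ∀ i, 0 < e i 0 := fun i => Nat.pos_of_ne_zero (hpos i 0)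
  have hp1 : ∀ i, 0 < e i 1 := fun i => Nat.pos_of_ne_zero (hpos i 1)
  have hp2 : ∀ i, 0 < e i 2 := fun i => Nat.pos_of_ne_zero (hpos i 2)
  have hd0 : ∀ i : ι, 0 < d := fun i => by have := hd i; have := hp0 i; omega
  have hex : ∀ a b r, a + b + r + 3 = d → ∃ l, e l 0 = a + 1 ∧ e l 1 = b + 1 ∧ e l 2 = r + 1 := by
    intro a b r h
    obtain ⟨l, hl⟩ := hsurj ![a + 1, b + 1, r + 1] (by intro c; fin_cases c <;> simp)
      (by simp; omega)
    exact ⟨l, by simp [hl], by simp [hl], by simp [hl]⟩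
  let X : ι → ℝ := fun i => e i 0
  let Y : ι → ℝ := fun i => e i 1
  let Z : ι → ℝ := fun i => e i 2
  let D : ι → ℝ := fun _ => d
  have hZ : Z = D - X - Y := by
    ext i
    have : (e i 0 + e i 1 + e i 2 : ℝ) = d := by exact_mod_cast hd i
    simp only [X, Y, Z, D, Pi.sub_apply]
    linarith
  -- falling factorials are triangular on the lattice points
  have hN : 0 < (of fun i j =>
      (shiftedFalling X (e j 0 - 1) * shiftedFalling Y (e j 1 - 1)) i).det := by
    rw [det_eq_prod_diag_of_grading (fun i => e i 0 + e i 1)]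
    · refine Finset.prod_pos fun i _ => ?_
      rw [of_apply, Pi.mul_apply, shiftedFalling_apply, shiftedFalling_apply]
      have := hp0 i
      have := hp1 i
      exact mul_pos (shiftedFalling_pos (by omega)) (shiftedFalling_pos (by omega))
    · intro i j hij hne
      rw [of_apply, Pi.mul_apply, shiftedFalling_apply, shiftedFalling_apply] at hij
      have h0 : e j 0 ≤ e i 0 := by
        by_contra! hlt
        exact hij (by rw [shiftedFalling_eq_zero (hp0 i) (by omega), zero_mul])
      have h1 : e j 1 ≤ e i 1 := by
        by_contra! hlt
        exact hij (by rw [shiftedFalling_eq_zero (hp1 i) (by omega), mul_zero])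
      -- A nonzero entry forces `e j ≤ e i` in the first two components; equal sums then make the
      -- indices equal.
      refine lt_of_le_of_ne (add_le_add h0 h1) fun heq => hne (he ?_)
      have := hd i
      have := hd j
      ext c
      fin_cases c <;> simp <;> omega
  have hM : 0 < (of fun i j => (X ^ (e j 0 - 1) * Y ^ (e j 1 - 1)) i).det := by
    rw [det_eq_of_sub_mem_span (fun i => e i 0 + e i 1 - 2)
      (fun j => X ^ (e j 0 - 1) * Y ^ (e j 1 - 1))] at hN
    · exact hN
    · intro j
      have h := shiftedFalling_sub_monomial_mem (X := X) (Y := Y) (n := d - 3)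
        (W := fun k => Submodule.span ℝ ((fun j => X ^ (e j 0 - 1) * Y ^ (e j 1 - 1)) ''
          {l | e l 0 + e l 1 - 2 < k}))
        (fun k m hkm => Submodule.span_mono (Set.image_mono fun l hl => lt_of_lt_of_le hl hkm))
        (fun a b hab => by
          obtain ⟨l, h0, h1, -⟩ := hex a b (d - 3 - a - b)
            (by have := hd j; have := hp0 j; have := hp1 j; have := hp2 j; omega)
          refine Submodule.subset_span ⟨l, ?_, ?_⟩
          · simp only [Set.mem_ofPred_eq]; omega
          · simp [h0, h1]) (e j 0 - 1) (e j 1 - 1) 0 0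
        (by have := hd j; have := hp0 j; have := hp1 j; have := hp2 j; omega)
      have hr : e j 0 - 1 + (e j 1 - 1) + 0 + 0 = e j 0 + e j 1 - 2 := by
        have := hp0 j; have := hp1 j; omega
      rw [hr] at h
      simpa using h
  have hH : 0 < (of fun i j => (X ^ (e j 0 - 1) * Y ^ (e j 1 - 1) * Z ^ (e j 2 - 1)) i).det := by
    -- The grade is the exponent of `D`, which is constant on the points, so its powers are mere
    -- column factors.
    rw [det_eq_of_sub_mem_span (fun i => e i 2 - 1)
      (fun j => X ^ (e j 0 - 1) * Y ^ (e j 1 - 1) * D ^ (e j 2 - 1))]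
    · refine det_mul_row_column_pos (fun _ => 1) (fun j => (d : ℝ) ^ (e j 2 - 1))
        (fun _ => one_pos) (fun j => pow_pos (by exact_mod_cast hd0 j) _) hM fun i j => ?_
      simp only [of_apply, Pi.mul_apply, Pi.pow_apply, D]
      ring
    · intro j
      have h := monomial_sub_monomial_mem (hZ := hZ) (n := d - 3)
        (V := fun k => Submodule.span ℝ
          ((fun j => X ^ (e j 0 - 1) * Y ^ (e j 1 - 1) * D ^ (e j 2 - 1)) ''
          {l | e l 2 - 1 < k}))
        (fun k m hkm => Submodule.span_mono (Set.image_mono fun l hl => lt_of_lt_of_le hl hkm))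
        (fun a b r hab => by
          obtain ⟨l, h0, h1, h2⟩ := hex a b r
            (by have := hd j; have := hp0 j; have := hp1 j; have := hp2 j; omega)
          refine Submodule.subset_span ⟨l, ?_, ?_⟩
          · simp only [Set.mem_ofPred_eq]; omega
          · simp [h0, h1, h2]) (e j 2 - 1) (e j 0 - 1) (e j 1 - 1) 0
        (by have := hd j; have := hp0 j; have := hp1 j; have := hp2 j; omega)
      simpa using h
  -- All exponents are positive, so one factor of each variable comes out of every row.
  refine det_mul_row_column_pos (fun i => X i * Y i * Z i) (fun _ => 1)
    (fun i => ?_) (fun _ => one_pos) hH fun i j => ?_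
  · have := hp0 i
    have := hp1 i
    have := hp2 i
    positivity
  · simp only [powMatrix, of_apply, Fin.prod_univ_three, Pi.mul_apply, Pi.pow_apply]
    rw [← Nat.sub_add_cancel (hp0 j), ← Nat.sub_add_cancel (hp1 j), ← Nat.sub_add_cancel (hp2 j)]
    simp only [Nat.add_sub_cancel, X, Y, Z]
    ring

theorem det_powMatrix_pos_of_complementary {n : ℕ} (p q : ι → ℕ) (hpq : ∀ i, p i + q i = n)
    (hinj : Function.Injective p) (hp : ∀ i, p i ≠ 0) (hq : ∀ i, q i ≠ 0) :
    0 < (of fun i j => (p i : ℝ) ^ p j * (q i : ℝ) ^ q j).det := by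
  have hp' : ∀ i, (0 : ℝ) < p i := fun i => by exact_mod_cast Nat.pos_of_ne_zero (hp i)
  have hq' : ∀ i, (0 : ℝ) < q i := fun i => by exact_mod_cast Nat.pos_of_ne_zero (hq i)
  have h := det_pow_pos_of_lt_imp_lt p hinj (fun i => (p i : ℝ) / q i) p
    (fun i j hij => by
      have h1 := hpq i
      have h2 := hpq j
      exact div_lt_div₀ (by exact_mod_cast hij) (by exact_mod_cast (by omega : q j ≤ q i))
        (hp' j).le (hq' j))
    (fun i j hij => hij) (fun i => div_pos (hp' i) (hq' i))
  refine det_mul_row_column_pos (fun i => (q i : ℝ) ^ n) (fun _ => 1)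
    (fun i => pow_pos (hq' i) _) (fun _ => one_pos) h fun i j => ?_
  have := (hq' i).ne'
  simp only [of_apply, div_pow, ← hpq j, pow_add]
  field_simp

theorem det_powMatrix_pos_of_fixed {d : ℕ} (e : ι → Fin 3 → ℕ) (he : Function.Injective e)
    (hd : ∀ i, e i 0 + e i 1 + e i 2 = d) (hsupp : ∀ i j c, e i c = 0 → e j c = 0)
    (c : Fin 3) (m : ℕ) (hm : ∀ i, e i c = m) : 0 < (powMatrix e).det := by
  obtain ⟨a, b, hsum, hprod⟩ : ∃ a b : Fin 3,
      (∀ f : Fin 3 → ℕ, f a + f b + f c = f 0 + f 1 + f 2) ∧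
      (∀ f : Fin 3 → ℝ, ∏ k, f k = f c * (f a * f b)) := by
    fin_cases c
    · exact ⟨1, 2, fun f => by simp; ring, fun f => by simp [Fin.prod_univ_three]; ring⟩
    · exact ⟨0, 2, fun f => by simp; ring, fun f => by simp [Fin.prod_univ_three]; ring⟩
    · exact ⟨0, 1, fun f => by simp, fun f => by simp [Fin.prod_univ_three]; ring⟩
  have hmd : ∀ i, e i a + e i b + m = d := fun i => by rw [← hd i, ← hsum, hm]
  have hab : ∀ i j, e i a = e j a → i = j := by
    intro i j hij
    refine he ?_
    have h1 := hmd i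
    have h2 := hmd j
    ext k
    have hk : k = a ∨ k = b ∨ k = c := by
      by_contra! hne
      -- Testing `hsum` on an indicator shows that `a`, `b`, `c` exhaust the components.
      have := hsum (Pi.single k 1)
      have h4 : ∑ l, (Pi.single k 1 : Fin 3 → ℕ) l = 1 := by simp
      rw [Fin.sum_univ_three] at h4
      simp [Pi.single_apply, hne.1.symm, hne.2.1.symm, hne.2.2.symm] at this h4
      omega
    rcases hk with rfl | rfl | rfl
    · exact hij
    · omega
    · rw [hm, hm]
  -- By `hsupp` such a zero is common to all indices, so two components are fixed and at most one
  -- index exists.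
  by_cases hz : ∃ i, e i a = 0 ∨ e i b = 0
  · have : Subsingleton ι := by
      obtain ⟨i, hi | hi⟩ := hz
      · exact ⟨fun j k => hab j k (by rw [hsupp i j a hi, hsupp i k a hi])⟩
      · refine ⟨fun j k => hab j k ?_⟩
        have := hsupp i j b hi
        have := hsupp i k b hi
        have := hmd j
        have := hmd k
        omega
    exact det_powMatrix_pos_of_subsingleton e
  · push Not at hz
    have h := det_powMatrix_pos_of_complementary (n := d - m) (fun i => e i a) (fun i => e i b)
      (fun i => by have := hmd i; omega) (fun i j => hab i j) (fun i => (hz i).1)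
      (fun i => (hz i).2)
    have hmm : (0 : ℝ) < (m : ℝ) ^ m := by
      rcases Nat.eq_zero_or_pos m with rfl | h
      · simp
      · positivity
    refine det_mul_row_column_pos (fun _ => (m : ℝ) ^ m) (fun _ => 1) (fun _ => hmm)
      (fun _ => one_pos) h fun i j => ?_
    rw [powMatrix, of_apply, hprod, hm, hm, of_apply, one_mul]

/-- In a component with values `a < b`, the right side divided by the left is `(b/a)^(b-a) > 1`.
This is the positivity of a 2×2 determinant. -/
theorem prod_pow_mul_lt {α : Type*} [Fintype α] {x y : α → ℕ} (hx : ∀ c, x c ≠ 0)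
    (hy : ∀ c, y c ≠ 0) (hxy : x ≠ y) :
    (∏ c, (x c : ℝ) ^ y c) * ∏ c, (y c : ℝ) ^ x c <
      (∏ c, (x c : ℝ) ^ x c) * ∏ c, (y c : ℝ) ^ y c := by
  have key : ∀ a b : ℕ, a < b → a ≠ 0 →
      (a : ℝ) ^ b * (b : ℝ) ^ a < (a : ℝ) ^ a * (b : ℝ) ^ b := by
    intro a b hab ha
    obtain ⟨k, rfl⟩ := Nat.exists_eq_add_of_lt hab
    have ha' : (0 : ℝ) < a := by exact_mod_cast Nat.pos_of_ne_zero ha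
    have hlt : (a : ℝ) ^ (k + 1) < ((a + k + 1 : ℕ) : ℝ) ^ (k + 1) :=
      pow_lt_pow_left₀ (by exact_mod_cast hab) ha'.le (by omega)
    have := mul_lt_mul_of_pos_left hlt
      (by positivity : (0 : ℝ) < (a : ℝ) ^ a * ((a + k + 1 : ℕ) : ℝ) ^ a)
    calc _ = (a : ℝ) ^ a * ((a + k + 1 : ℕ) : ℝ) ^ a * (a : ℝ) ^ (k + 1) := by
          rw [show a + k + 1 = a + (k + 1) by ring, pow_add (a : ℝ) a]; ring
      _ < _ := this
      _ = _ := by rw [mul_assoc, ← pow_add]; ring_nf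
  have key2 : ∀ c, x c ≠ y c →
      (x c : ℝ) ^ y c * (y c : ℝ) ^ x c < (x c : ℝ) ^ x c * (y c : ℝ) ^ y c := by
    intro c hc
    rcases lt_or_gt_of_ne hc with h | h
    · exact key _ _ h (hx c)
    · have := key _ _ h (hy c)
      linarith
  rw [← Finset.prod_mul_distrib, ← Finset.prod_mul_distrib]
  obtain ⟨c, hc⟩ := Function.ne_iff.mp hxy
  refine Finset.prod_lt_prod (fun c _ => ?_) (fun c _ => ?_) ⟨c, Finset.mem_univ _, key2 c hc⟩
  · have := Nat.pos_of_ne_zero (hx c)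
    have := Nat.pos_of_ne_zero (hy c)
    positivity
  · by_cases h : x c = y c
    · rw [h]
    · exact (key2 c h).le

theorem det_powMatrix_pos_of_card_le_two (e : ι → Fin 3 → ℕ) (he : Function.Injective e)
    (hpos : ∀ i c, e i c ≠ 0) (hcard : Fintype.card ι ≤ 2) : 0 < (powMatrix e).det := by
  rcases Nat.lt_or_ge (Fintype.card ι) 2 with h | h
  · have := Fintype.card_le_one_iff_subsingleton.mp (Nat.le_of_lt_succ h)
    exact det_powMatrix_pos_of_subsingleton e
  · let f := (Fintype.equivFinOfCardEq (le_antisymm hcard h)).symm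
    rw [← det_submatrix_equiv_self f, det_fin_two, sub_pos]
    exact prod_pow_mul_lt (hpos _) (hpos _) (he.ne (f.injective.ne (by decide)))

/-- The matrix of monomials is block triangular with respect to the supports of the indices, and
the blocks that belong to the boundary of the triangle have positive determinant. -/
theorem det_powMatrix_pos_of_interior_block {d : ℕ} (e : ι → Fin 3 → ℕ)
    (he : Function.Injective e) (hd : ∀ i, e i 0 + e i 1 + e i 2 = d)
    (h : 0 < (powMatrix fun i : {i // ∀ c, e i c ≠ 0} => e i).det) : 0 < (powMatrix e).det := by
  -- Binary code of the set of zero components: monotone under inclusion, and 0 exactly on the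
  -- interior.
  let b : ι → ℕ := fun i => (if e i 0 = 0 then 1 else 0) + (if e i 1 = 0 then 2 else 0) +
    (if e i 2 = 0 then 4 else 0)
  have hb0 : ∀ i, b i = 0 ↔ ∀ c, e i c ≠ 0 := by
    intro i
    rw [Fin.forall_fin_succ, Fin.forall_fin_two]
    simp [b, and_assoc]
  have hbeq : ∀ i j, b i = b j → ∀ c, e i c = 0 → e j c = 0 := by
    intro i j hij c
    simp only [b] at hij
    fin_cases c <;> intro hc <;> by_contra hne <;> simp at hc hne <;> simp [hc, hne] at hij <;>
      split_ifs at hij <;> omega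
  have htri : (powMatrix e).BlockTriangular b := by
    intro i j hij
    by_contra hne
    have hz : ∀ c, e i c = 0 → e j c = 0 := by
      intro c hc
      by_contra hj
      rw [powMatrix, of_apply] at hne
      exact hne (Finset.prod_eq_zero (Finset.mem_univ c) (by simp [hc, hj]))
    refine not_le_of_gt hij ?_
    have aux : ∀ (c : Fin 3) (w : ℕ), (if e i c = 0 then w else 0) ≤ if e j c = 0 then w else 0 := by
      intro c w
      by_cases hc : e i c = 0
      · simp [hc, hz c hc]
      · simp [hc]
    exact add_le_add (add_le_add (aux 0 1) (aux 1 2)) (aux 2 4)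
  rw [htri.det]
  refine Finset.prod_pos fun k _ => ?_
  rcases Nat.eq_zero_or_pos k with rfl | hk
  · have h1 := equiv_block_det (powMatrix e) (p := fun i => ∀ c, e i c ≠ 0) (q := fun i => b i = 0)
      hb0
    refine lt_of_lt_of_eq h ?_
    exact h1
  · have hinj : Function.Injective fun i : {i // b i = k} => e i :=
      he.comp Subtype.val_injective
    have hsupp : ∀ (i j : {i // b i = k}) (c : Fin 3), e i c = 0 → e j c = 0 :=
      fun i j => hbeq i j (i.2.trans j.2.symm)
    change 0 < (powMatrix fun i : {i // b i = k} => e i).det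
    cases isEmpty_or_nonempty {i // b i = k} with
    | inl _ => simp
    | inr hne =>
      obtain ⟨i⟩ := hne
      have : ¬ ∀ c, e i c ≠ 0 := fun hall => by
        have := (hb0 i).mpr hall
        have := i.2
        omega
      push Not at this
      obtain ⟨c, hc⟩ := this
      exact det_powMatrix_pos_of_fixed _ hinj (fun i => hd i) hsupp c 0
        fun j => hsupp i j c hc

end PowMatrix

/-! ### Return to the Bernstein collocation matrix -/

theorem mem_indices {d : ℕ} {i : Fin 3 → ℕ} : i ∈ indices d ↔ i 0 + i 1 + i 2 = d := by
  rw [indices, Finset.Nat.mem_antidiagonalTuple, Fin.sum_univ_three]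

theorem mem_indicesWithZeros_zero {d : ℕ} {i : Fin 3 → ℕ} :
    i ∈ indicesWithZeros d 0 ↔ i ∈ indices d ∧ ∀ c, i c ≠ 0 := by
  simp [indicesWithZeros, Finset.filter_eq_empty_iff]

theorem IsBoundary.exists_eq_zero {d : ℕ} {Γ : Finset (Fin 3 → ℕ)} (h : IsBoundary d Γ)
    {i : Fin 3 → ℕ} (hi : i ∈ Γ) : ∃ c, i c = 0 := by
  by_contra! hne
  have := h hi
  simp [indicesWithZeros, hne] at this

theorem det_collocationMatrix_pos_of_powMatrix {d : ℕ} (hd : 0 < d) {Γ : Finset (Fin 3 → ℕ)}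
    (hΓ : Γ ⊆ indices d) (h : 0 < (powMatrix fun i : Γ => i.1).det) :
    0 < (collocationMatrix d Γ).det := by
  have hd' : (0 : ℝ) < d := by exact_mod_cast hd
  refine det_mul_row_column_pos (fun _ => 1) (fun j => (d.factorial : ℝ) /
    ((j.1 0).factorial * (j.1 1).factorial * (j.1 2).factorial) / (d : ℝ) ^ d)
    (fun _ => one_pos) (fun j => by positivity) h fun i j => ?_
  have hj := mem_indices.mp (hΓ j.2)
  simp only [collocationMatrix, bernsteinPoly, domainPoint, powMatrix, of_apply,
    Fin.prod_univ_three, div_pow]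
  have hpow : (d : ℝ) ^ d = (d : ℝ) ^ (j.1 0) * (d : ℝ) ^ (j.1 1) * (d : ℝ) ^ (j.1 2) := by
    rw [← pow_add, ← pow_add, hj]
  rw [hpow]
  field_simp

/-- Only the interior indices of `Γ` are constrained, so adjoining boundary indices costs nothing
and all six assumptions are covered. -/
theorem det_collocationMatrix_pos_of_interior {d : ℕ} (hd : 0 < d) {Γ : Finset (Fin 3 → ℕ)}
    (hΓ : Γ ⊆ indices d)
    (h : (∃ Γ₁, AtMostTwo Γ₁ ∧ ∀ i ∈ Γ, (∀ c, i c ≠ 0) → i ∈ Γ₁) ∨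
      (∃ Γ₁, OneComponentFixed Γ₁ ∧ ∀ i ∈ Γ, (∀ c, i c ≠ 0) → i ∈ Γ₁) ∨
      indicesWithZeros d 0 ⊆ Γ) :
    0 < (collocationMatrix d Γ).det := by
  refine det_collocationMatrix_pos_of_powMatrix hd hΓ ?_
  have hsum : ∀ i : Γ, i.1 0 + i.1 1 + i.1 2 = d := fun i => mem_indices.mp (hΓ i.2)
  refine det_powMatrix_pos_of_interior_block _ Subtype.val_injective hsum ?_
  have hinj : Function.Injective fun i : {i : Γ // ∀ c, i.1 c ≠ 0} => i.1.1 :=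
    Subtype.val_injective.comp Subtype.val_injective
  rcases h with ⟨Γ₁, h, hsub⟩ | ⟨Γ₁, ⟨c, m, h⟩, hsub⟩ | h
  · refine det_powMatrix_pos_of_card_le_two _ hinj (fun i => i.2) ?_
    refine le_trans ?_ h
    rw [← Fintype.card_coe Γ₁]
    exact Fintype.card_le_of_injective (fun i => ⟨i.1.1, hsub _ i.1.2 i.2⟩)
      fun i j hij => hinj (congrArg (fun x : Γ₁ => x.1) hij)
  · exact det_powMatrix_pos_of_fixed _ hinj (fun i => hsum i.1)
      (fun i _ c h0 => absurd h0 (i.2 c)) c m fun i => h _ (hsub _ i.1.2 i.2)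
  · refine det_powMatrix_pos_of_interior _ hinj (fun i => hsum i.1) (fun i => i.2)
      fun f hf hfd => ?_
    exact ⟨⟨⟨f, h (mem_indicesWithZeros_zero.mpr ⟨mem_indices.mpr hfd, hf⟩)⟩, hf⟩, rfl⟩

end BezierTriangle

theorem theorem3 (d : ℕ) (hd : 0 < d) (Γ : Finset (Fin 3 → ℕ))
    (hΓ : Γ ⊆ BezierTriangle.indices d)
    (h : BezierTriangle.AtMostTwo Γ ∨
      BezierTriangle.OneComponentFixed Γ ∨
      Γ = BezierTriangle.indices d ∨
      Γ = BezierTriangle.indicesWithZeros d 0 ∨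
      BezierTriangle.IsBoundary d Γ ∨
      ∃ Γ₁ Γ₂ : Finset (Fin 3 → ℕ), Γ = Γ₁ ∪ Γ₂ ∧
        (BezierTriangle.AtMostTwo Γ₁ ∨ BezierTriangle.OneComponentFixed Γ₁ ∨
          Γ₁ = BezierTriangle.indicesWithZeros d 0) ∧
        BezierTriangle.IsBoundary d Γ₂) :
    0 < (BezierTriangle.collocationMatrix d Γ).det := by
  refine BezierTriangle.det_collocationMatrix_pos_of_interior hd hΓ ?_
  rcases h with h | h | rfl | rfl | h | ⟨Γ₁, Γ₂, rfl, h, hb⟩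
  · exact Or.inl ⟨Γ, h, fun i hi _ => hi⟩
  · exact Or.inr (Or.inl ⟨Γ, h, fun i hi _ => hi⟩)
  · exact Or.inr (Or.inr fun i hi => (BezierTriangle.mem_indicesWithZeros_zero.mp hi).1)
  · exact Or.inr (Or.inr subset_rfl)
  · refine Or.inl ⟨∅, by simp [BezierTriangle.AtMostTwo], fun i hi hne => ?_⟩
    obtain ⟨c, hc⟩ := h.exists_eq_zero hi
    exact absurd hc (hne c)
  · have hsub : ∀ i ∈ Γ₁ ∪ Γ₂, (∀ c, i c ≠ 0) → i ∈ Γ₁ := by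
      intro i hi hne
      refine (Finset.mem_union.mp hi).resolve_right fun h2 => ?_
      obtain ⟨c, hc⟩ := hb.exists_eq_zero h2
      exact hne c hc
    rcases h with h | h | rfl
    · exact Or.inl ⟨Γ₁, h, hsub⟩
    · exact Or.inr (Or.inl ⟨Γ₁, h, hsub⟩)
    · exact Or.inr (Or.inr Finset.subset_union_left)
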